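/- **Conventions.** For a group $G$, a subset $S\subseteq G$ and $x\in G$, the length $|x|_S$ is the least $k\ge 0$ such that $x$ is a product of $k$ elements of $S\cup S^{-1}$ ($\infty$ if there is none), and the width of $G$ relative to $S$ is $\operatorname{wid}(G,S)=\sup_{x\in G}|x|_S\in\mathbf N\cup\{\infty\}$. The group $G$ is *of universally finite width* if $\operatorname{wid}(G,S)<\infty$ for every generating set $S$ of $G$. Let $\mathbf V$ be a variety of (finitary, one-sorted) algebras, and let $F\in\mathbf V$ be a free algebra of infinite rank, i.e. one with an infinite free basis. A subalgebra $U$ of $F$ is *moietous* if $U$ is generated by a subset $J$ of some infinite free basis $B$ of $F$ with $|J|=|B\setminus J|$. We write $F=U_1*U_2*W$ if $F$ is the free product (coproduct in $\mathbf V$) of its subalgebras $U_1,U_2,W$; then $U_i*W$ denotes the subalgebra generated by $U_i\cup W$. For $G=\operatorname{Aut}(F)$ and subalgebras $A,C$ of $F$, let $G_{(A),\{C\}}$ be the subgroup of all $\sigma\in G$ that fix $A$ pointwise and satisfy $\sigma(C)=C$. The variety $\mathbf V$ is a *BMN-variety* if for every free algebra $F\in\mathbf V$ of infinite rank and all moietous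 subalgebras $U_1,U_2,W$ of $F$ with $F=U_1*U_2*W$, the group $G=\operatorname{Aut}(F)$ is generated by the subgroups $G_{(U_2),\{U_1*W\}}$ and $G_{(U_1),\{U_2*W\}}$. **Theorem.** Let $\mathbf V$ be a BMN-variety, let $F\in\mathbf V$ be a free algebra of infinite rank, and let $G=\operatorname{Aut}(F)$. Then $G$ is a group of universally finite width if and only if there are moietous subalgebras $U_1,U_2,W$ of $F$ with $F=U_1*U_2*W$ such that $$\operatorname{wid}\bigl(G,\;G_{(U_2),\{U_1*W\}}\cup G_{(U_1),\{U_2*W\}}\bigr)<\infty .$$ Moreover, for each choice of moietous subalgebras $U_1,U_2,W$ of $F$ with $F=U_1*U_2*W$, the group $G$ is of universally finite width if and only if this width is finite. -/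

import Mathlib

open scoped FirstOrder
open scoped Pointwise

universe u v w

namespace BMN

section Width

variable {G : Type*} [Group G]

/-- The length of `x` relative to `S`: the least number of factors in an expression of `x` as a
product of elements of `S ∪ S⁻¹` (`⊤` if there is no such expression; the identity has
length `0`, being the empty product). -/
noncomputable def length (S : Set G) (x : G) : ℕ∞ :=
  ⨅ (l : List G) (_ : (∀ y ∈ l, y ∈ S ∪ S⁻¹) ∧ l.prod = x), (l.length : ℕ∞)

/-- The width of `G` relative to `S`: the supremum of the lengths of the elements of `G`. -/
noncomputable def width (S : Set G) : ℕ∞ :=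
  ⨆ x : G, length S x

variable (G) in
/-- `G` is of universally finite width: its width relative to every generating set is finite. -/
def UniversallyFiniteWidth : Prop :=
  ∀ S : Set G, Subgroup.closure S = ⊤ → width S ≠ ⊤

end Width

section Aut

variable {L : FirstOrder.Language.{u, v}} {F : Type w} [L.Structure F]

/-- The automorphism group of an algebra; `(σ * τ) x = σ (τ x)`. -/
instance autGroup : Group (F ≃[L] F) where
  mul σ τ := σ.comp τ
  one := FirstOrder.Language.Equiv.refl L F
  inv σ := σ.symm
  mul_assoc _ _ _ := rfl
  one_mul _ := rfl
  mul_one _ := rfl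
  inv_mul_cancel σ := FirstOrder.Language.Equiv.symm_comp_self σ

/-- The natural action of the automorphism group; `σ • x = σ x`. -/
instance autMulAction : MulAction (F ≃[L] F) F where
  smul σ x := σ x
  one_smul _ := rfl
  mul_smul _ _ _ := rfl

/-- For subalgebras `A`, `B`, the subgroup of all automorphisms that fix `A` pointwise and fix
`B` setwise. -/
def fixStab (A B : L.Substructure F) : Subgroup (F ≃[L] F) :=
  fixingSubgroup (F ≃[L] F) (A : Set F) ⊓ MulAction.stabilizer (F ≃[L] F) (B : Set F)

end Aut

section Variety

variable {L : FirstOrder.Language.{u, v}}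

/-- A set of identities `s ≈ t` in the variables `x₀, x₁, …`. With `L` having operation symbols
only, the algebras satisfying it form a variety, and every variety is of this form. -/
abbrev Identities (L : FirstOrder.Language.{u, v}) : Type u :=
  Set (L.Term ℕ × L.Term ℕ)

/-- The algebra `M` belongs to the variety defined by `E`. -/
def InVariety (E : Identities L) (M : Type*) [L.Structure M] : Prop :=
  ∀ e ∈ E, ∀ x : ℕ → M, e.1.realize x = e.2.realize x

/-- `F` is a free algebra of the variety defined by `E`, with free basis `B`. The universe of the
test algebras `M` is large enough to contain the term model of a free algebra on `B`. -/
def IsBasis (E : Identities L) {F : Type w} [L.Structure F] (B : Set F) : Prop :=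
  InVariety E F ∧
    ∀ (M : Type (max u w)) [L.Structure M], InVariety E M →
      ∀ f : B → M, ∃! g : F →[L] M, ∀ b : B, g b = f b

/-- `F` is a free algebra of infinite rank of the variety defined by `E`. -/
def IsFreeOfInfiniteRank (E : Identities L) (F : Type w) [L.Structure F] : Prop :=
  ∃ B : Set F, IsBasis E B ∧ B.Infinite

/-- A subalgebra is moietous if it is generated by a moiety `J` of an infinite free basis `B`,
that is, by a subset `J` of `B` with `|J| = |B \ J|`. -/
def IsMoietous (E : Identities L) {F : Type w} [L.Structure F] (U : L.Substructure F) : Prop :=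
  ∃ B : Set F, IsBasis E B ∧ B.Infinite ∧
    ∃ J ⊆ B, Cardinal.mk J = Cardinal.mk (B \ J : Set F) ∧ U = FirstOrder.Language.Substructure.closure L J

/-- `F` is the (internal) free product `U₁ * U₂ * W` of its subalgebras, that is, their coproduct
in the variety defined by `E`. -/
def IsFreeProduct (E : Identities L) {F : Type w} [L.Structure F]
    (U₁ U₂ W : L.Substructure F) : Prop :=
  InVariety E F ∧
    ∀ (M : Type (max u w)) [L.Structure M], InVariety E M →
      ∀ (f₁ : U₁ →[L] M) (f₂ : U₂ →[L] M) (f₃ : W →[L] M),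
        ∃! g : F →[L] M, (∀ x : U₁, g x = f₁ x) ∧ (∀ x : U₂, g x = f₂ x) ∧ (∀ x : W, g x = f₃ x)

/-- `U₁`, `U₂`, `W` are moietous subalgebras of `F` and `F = U₁ * U₂ * W`. -/
def IsMoietousFactorization (E : Identities L) {F : Type w} [L.Structure F]
    (U₁ U₂ W : L.Substructure F) : Prop :=
  IsMoietous E U₁ ∧ IsMoietous E U₂ ∧ IsMoietous E W ∧ IsFreeProduct E U₁ U₂ W

/-- The union of the subgroups `G_{(U₂),{U₁ * W}}` and `G_{(U₁),{U₂ * W}}` of `G = Aut F`; here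
`U₁ * W` and `U₂ * W` are the subalgebras of `F` generated by the two factors. -/
def macphersonSet {F : Type w} [L.Structure F] (U₁ U₂ W : L.Substructure F) : Set (F ≃[L] F) :=
  (fixStab U₂ (U₁ ⊔ W) : Set (F ≃[L] F)) ∪ (fixStab U₁ (U₂ ⊔ W) : Set (F ≃[L] F))

/-- The variety defined by `E` is a BMN-variety (for its algebras with carrier in `Type w`). -/
def IsBMNVariety (E : Identities L) : Prop :=
  ∀ (F : Type w) [L.Structure F], IsFreeOfInfiniteRank E F →
    ∀ U₁ U₂ W : L.Substructure F, IsMoietousFactorization E U₁ U₂ W →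
      Subgroup.closure (macphersonSet U₁ U₂ W) = ⊤

end Variety

end BMN

/-! One direction is immediate: in a BMN-variety the union of the two subgroups generates `G`. For
the converse it suffices to bound the `S`-length of the elements of both subgroups, for an arbitrary
generating set `S`, and this does not need the BMN property.

Bases of the three factors combine to a free basis of `F`, and by invariance of rank all three have
the same cardinality. Each of the two subgroups therefore consists of automorphisms supported by a
moiety: they stabilize the span of a moiety `T` of the basis and fix the rest of the basis.

To bound their length, index the basis by `T × ℤ × ℕ`. A diagonal argument over the `ℕ`-coordinate
(`exists_full`) finds `n` such that every automorphism of the `n`-th factor is induced by one of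
length at most `n` stabilizing the complementary factor. A swindle along `ℤ` (`exists_commutator`)
writes each automorphism supported by the layer `(0, n)` as a commutator of some `α` with one fixed
shift `ρ`. Since `ρ` is trivial outside the `n`-th factor, `α` may be replaced by an automorphism of
length at most `n`. A permutation of the basis carries the layer to `T`. -/

namespace BMN

/-! ### Length and width in groups -/

section Width

variable {G : Type*} [Group G] {S : Set G} {x y : G}

theorem length_le_coe_iff {n : ℕ} :
    length S x ≤ n ↔
      ∃ l : List G, (∀ y ∈ l, y ∈ S ∪ S⁻¹) ∧ l.prod = x ∧ l.length ≤ n := by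
  constructor
  · intro h
    by_contra! hc
    have : ((n + 1 : ℕ) : ℕ∞) ≤ length S x :=
      le_iInf₂ fun l hl => by exact_mod_cast hc l hl.1 hl.2
    have := this.trans h
    norm_cast at this
    omega
  · rintro ⟨l, h₁, h₂, h₃⟩
    exact iInf₂_le_of_le l ⟨h₁, h₂⟩ (by exact_mod_cast h₃)

theorem length_mul_le {m n : ℕ} (hx : length S x ≤ m) (hy : length S y ≤ n) :
    length S (x * y) ≤ (m + n : ℕ) := by
  obtain ⟨l, h₁, rfl, h₃⟩ := length_le_coe_iff.1 hx
  obtain ⟨l', h₁', rfl, h₃'⟩ := length_le_coe_iff.1 hy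
  refine length_le_coe_iff.2 ⟨l ++ l', ?_, List.prod_append, ?_⟩
  · intro z hz
    exact (List.mem_append.1 hz).elim (h₁ z) (h₁' z)
  · rw [List.length_append]
    omega

theorem length_inv_le {m : ℕ} (hx : length S x ≤ m) : length S x⁻¹ ≤ m := by
  obtain ⟨l, h₁, rfl, h₃⟩ := length_le_coe_iff.1 hx
  refine length_le_coe_iff.2 ⟨(l.map (·⁻¹)).reverse, ?_, (List.prod_inv_reverse l).symm, by simpa⟩
  intro z hz
  obtain ⟨y, hy, rfl⟩ := List.mem_map.1 (List.mem_reverse.1 hz)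
  rcases h₁ y hy with h | h
  · exact Or.inr (by simpa using h)
  · exact Or.inl h

theorem exists_length_le (hS : Subgroup.closure S = ⊤) (x : G) :
    ∃ n : ℕ, length S x ≤ n := by
  have hx : x ∈ (Subgroup.closure S).toSubmonoid := hS ▸ Subgroup.mem_top x
  rw [Subgroup.closure_toSubmonoid] at hx
  obtain ⟨l, hl, rfl⟩ := Submonoid.exists_list_of_mem_closure hx
  exact ⟨l.length, length_le_coe_iff.2 ⟨l, fun y hy => hl y hy, rfl, le_rfl⟩⟩

theorem length_list_prod_le {k : ℕ} {l : List G} (h : ∀ y ∈ l, length S y ≤ k) :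
    length S l.prod ≤ (k * l.length : ℕ) := by
  induction l with
  | nil => exact length_le_coe_iff.2 ⟨[], by simp⟩
  | cons a l ih =>
    rw [List.prod_cons, List.length_cons, Nat.mul_succ, Nat.add_comm]
    exact length_mul_le (h a (by simp)) (ih fun y hy => h y (by simp [hy]))

/-- If the width relative to `T` is finite, so is the width relative to every set `S` with respect
to which the elements of `T` have bounded length. -/
theorem width_ne_top_of_length_le {T : Set G} {k : ℕ} (hT : width T ≠ ⊤)
    (h : ∀ t ∈ T, length S t ≤ k) : width S ≠ ⊤ := by
  obtain ⟨n, hn⟩ := ENat.ne_top_iff_exists.1 hT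
  refine ne_top_of_le_ne_top (ENat.natCast_ne_top (k * n)) (iSup_le fun x => ?_)
  have hx : length T x ≤ n := (le_iSup (length T) x).trans hn.ge
  obtain ⟨l, h₁, rfl, h₃⟩ := length_le_coe_iff.1 hx
  refine (length_list_prod_le fun y hy => ?_).trans
    (by exact_mod_cast Nat.mul_le_mul_left k h₃)
  rcases h₁ y hy with hy | hy
  · exact h y hy
  · simpa using length_inv_le (h _ hy)

end Width

/-! ### Automorphisms and stabilizers of subalgebras -/

section Stabilizers

variable {L : FirstOrder.Language.{u, v}} {F : Type w} [L.Structure F]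

open FirstOrder.Language FirstOrder.Language.Substructure

theorem aut_mul_apply (σ τ : F ≃[L] F) (x : F) : (σ * τ) x = σ (τ x) := rfl

theorem aut_one_apply (x : F) : (1 : F ≃[L] F) x = x := rfl

theorem aut_inv_apply_self (σ : F ≃[L] F) (x : F) : σ⁻¹ (σ x) = x := σ.symm_apply_apply x

theorem aut_apply_inv_self (σ : F ≃[L] F) (x : F) : σ (σ⁻¹ x) = x := σ.apply_symm_apply x

/-- The setwise stabilizer of a subalgebra in the automorphism group. -/
def setStab (A : L.Substructure F) : Subgroup (F ≃[L] F) :=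
  MulAction.stabilizer (F ≃[L] F) (A : Set F)

theorem apply_mem_of_mem_setStab {A : L.Substructure F} {σ : F ≃[L] F} (hσ : σ ∈ setStab A)
    {x : F} (hx : x ∈ A) : σ x ∈ A := by
  have h : σ • (A : Set F) = A := hσ
  have : σ • x ∈ σ • (A : Set F) := Set.smul_mem_smul_set hx
  rwa [h] at this

theorem mem_setStab_iff {A : L.Substructure F} {σ : F ≃[L] F} :
    σ ∈ setStab A ↔ ∀ x ∈ A, σ x ∈ A ∧ σ⁻¹ x ∈ A := by
  constructor
  · exact fun h x hx => ⟨apply_mem_of_mem_setStab h hx, apply_mem_of_mem_setStab (inv_mem h) hx⟩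
  · intro h
    change σ • (A : Set F) = A
    apply Set.Subset.antisymm
    · rintro _ ⟨x, hx, rfl⟩
      exact (h x hx).1
    · intro x hx
      exact ⟨σ⁻¹ x, (h x hx).2, aut_apply_inv_self σ x⟩

theorem aut_apply_mem_closure {A : L.Substructure F} {s : Set F} {σ : F ≃[L] F}
    (h : ∀ x ∈ s, σ x ∈ A) {x : F} (hx : x ∈ closure L s) : σ x ∈ A :=
  (closure_le (S := A.comap σ.toHom)).2 h hx

theorem mem_setStab_closure_iff {s : Set F} {σ : F ≃[L] F} :
    σ ∈ setStab (closure L s) ↔ ∀ x ∈ s, σ x ∈ closure L s ∧ σ⁻¹ x ∈ closure L s := by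
  refine mem_setStab_iff.trans ⟨fun h x hx => h x (subset_closure hx), fun h x hx => ⟨?_, ?_⟩⟩
  · exact aut_apply_mem_closure (fun x hx => (h x hx).1) hx
  · exact aut_apply_mem_closure (fun x hx => (h x hx).2) hx

theorem aut_eqOn_closure {s : Set F} {σ τ : F ≃[L] F} (h : ∀ x ∈ s, σ x = τ x) {x : F}
    (hx : x ∈ closure L s) : σ x = τ x :=
  Hom.eqOn_closure (f := σ.toHom) (g := τ.toHom) h hx

theorem mem_fixStab_iff {A B : L.Substructure F} {σ : F ≃[L] F} :
    σ ∈ fixStab A B ↔ (∀ x ∈ A, σ x = x) ∧ σ ∈ setStab B := by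
  refine Iff.and ?_ Iff.rfl
  exact mem_fixingSubgroup_iff (F ≃[L] F)

end Stabilizers

/-! ### Free families and their automorphisms -/

section FreeOn

variable {L : FirstOrder.Language.{u, v}} {F : Type w} [L.Structure F]

open FirstOrder.Language FirstOrder.Language.Substructure

/-- The family `b` generates `F`, and every map from `b` to `F` extends to an endomorphism. -/
def FreeOn (L : FirstOrder.Language.{u, v}) {F : Type w} [L.Structure F] {ι : Type*}
    (b : ι → F) : Prop :=
  closure L (Set.range b) = ⊤ ∧ ∀ f : ι → F, ∃ g : F →[L] F, ∀ i, g (b i) = f i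

variable {ι κ : Type*} {b : ι → F}

/-- The subalgebra generated by the members of the family `b` with index in `T`. -/
def span (L : FirstOrder.Language.{u, v}) {F : Type w} [L.Structure F] {ι : Type*}
    (b : ι → F) (T : Set ι) : L.Substructure F :=
  closure L (b '' T)

theorem mem_span {T : Set ι} {i : ι} (hi : i ∈ T) : b i ∈ span L b T :=
  subset_closure (Set.mem_image_of_mem b hi)

theorem span_mono {T T' : Set ι} (h : T ⊆ T') : span L b T ≤ span L b T' :=
  closure_mono (Set.image_mono h)

theorem span_comp (e : κ → ι) (T : Set κ) : span L (b ∘ e) T = span L b (e '' T) := by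
  rw [span, span, Set.image_comp]

theorem aut_apply_mem_span {T : Set ι} {A : L.Substructure F} {σ : F ≃[L] F}
    (h : ∀ i ∈ T, σ (b i) ∈ A) {x : F} (hx : x ∈ span L b T) : σ x ∈ A :=
  aut_apply_mem_closure (Set.forall_mem_image.2 h) hx

theorem aut_eqOn_span {T : Set ι} {σ τ : F ≃[L] F} (h : ∀ i ∈ T, σ (b i) = τ (b i)) {x : F}
    (hx : x ∈ span L b T) : σ x = τ x :=
  aut_eqOn_closure (Set.forall_mem_image.2 h) hx

theorem mem_setStab_span_iff {T : Set ι} {σ : F ≃[L] F} :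
    σ ∈ setStab (span L b T) ↔ ∀ i ∈ T, σ (b i) ∈ span L b T ∧ σ⁻¹ (b i) ∈ span L b T :=
  mem_setStab_closure_iff.trans Set.forall_mem_image

/-- Any two moieties of an infinite set are conjugate under its permutations; this later moves a
layer of the basis onto a given moiety. -/
theorem exists_perm_of_equiv {A T : Set ι} (f₁ : A ≃ T) (f₂ : (Aᶜ : Set ι) ≃ (Tᶜ : Set ι)) :
    ∃ π : Equiv.Perm ι, (∀ i ∈ A, π i ∈ T) ∧ ∀ i ∉ A, π i ∉ T := by
  classical
  let π : Equiv.Perm ι := Equiv.subtypeCongr (p := (· ∈ A)) (q := (· ∈ T)) f₁ f₂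
  refine ⟨π, fun i hi => ?_, fun i hi => ?_⟩
  · have : π i = f₁ ⟨i, hi⟩ := by simp [π, Equiv.subtypeCongr, Equiv.sumCompl, hi]
    rw [this]
    exact (f₁ _).2
  · have : π i = f₂ ⟨i, hi⟩ := by simp [π, Equiv.subtypeCongr, Equiv.sumCompl, hi]
    rw [this]
    exact (f₂ _).2

namespace FreeOn

theorem comp_equiv (hb : FreeOn L b) (e : κ ≃ ι) : FreeOn L (b ∘ e) := by
  refine ⟨by rw [e.surjective.range_comp]; exact hb.1, fun f => ?_⟩
  obtain ⟨g, hg⟩ := hb.2 (f ∘ e.symm)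
  exact ⟨g, fun i => by simp [hg]⟩

theorem hom_ext (hb : FreeOn L b) {g h : F →[L] F} (H : ∀ i, g (b i) = h (b i)) : g = h :=
  Hom.eq_of_eqOn_dense hb.1 (Set.forall_mem_range.2 H)

theorem aut_ext (hb : FreeOn L b) {σ τ : F ≃[L] F} (H : ∀ i, σ (b i) = τ (b i)) : σ = τ := by
  ext x
  exact DFunLike.congr_fun (hb.hom_ext (g := σ.toHom) (h := τ.toHom) H) x

variable [L.IsAlgebraic]

/-- The endomorphisms extending `f` and `f'` are mutually inverse because both composites fix the
generators. Without relation symbols such a pair is already an isomorphism. -/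
theorem exists_aut (hb : FreeOn L b) (f f' : ι → F)
    (h : ∀ φ : F →[L] F, (∀ i, φ (b i) = f' i) → ∀ i, φ (f i) = b i)
    (h' : ∀ φ : F →[L] F, (∀ i, φ (b i) = f i) → ∀ i, φ (f' i) = b i) :
    ∃ σ : F ≃[L] F, ∀ i, σ (b i) = f i := by
  obtain ⟨φ, hφ⟩ := hb.2 f
  obtain ⟨ψ, hψ⟩ := hb.2 f'
  have h₁ : ψ.comp φ = Hom.id L F := hb.hom_ext fun i => by
    rw [Hom.comp_apply, hφ, h ψ hψ, Hom.id_apply]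
  have h₂ : φ.comp ψ = Hom.id L F := hb.hom_ext fun i => by
    rw [Hom.comp_apply, hψ, h' φ hφ, Hom.id_apply]
  exact ⟨{ toFun := φ
           invFun := ψ
           left_inv := DFunLike.congr_fun h₁
           right_inv := DFunLike.congr_fun h₂
           map_fun' := φ.map_fun
           map_rel' := fun r => isEmptyElim r }, hφ⟩

/-- A permutation of a free basis extends to an automorphism. -/
theorem exists_aut_perm (hb : FreeOn L b) (π : Equiv.Perm ι) :
    ∃ σ : F ≃[L] F, ∀ i, σ (b i) = b (π i) :=
  hb.exists_aut _ (fun i => b (π.symm i)) (fun φ hφ i => by simp [hφ])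
    (fun φ hφ i => by simp [hφ])

/-- Automorphisms stabilizing the factors of a free decomposition can be combined. -/
theorem exists_aut_glue (hb : FreeOn L b) (p : ι → κ) (τ : κ → F ≃[L] F)
    (hτ : ∀ k, τ k ∈ setStab (span L b (p ⁻¹' {k}))) :
    ∃ σ : F ≃[L] F, ∀ k, ∀ x ∈ span L b (p ⁻¹' {k}), σ x = τ k x ∧ σ⁻¹ x = (τ k)⁻¹ x := by
  have key : ∀ (τ : κ → F ≃[L] F), (∀ k, τ k ∈ setStab (span L b (p ⁻¹' {k}))) →
      ∀ φ : F →[L] F, (∀ i, φ (b i) = (τ (p i))⁻¹ (b i)) → ∀ i, φ (τ (p i) (b i)) = b i := by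
    intro τ hτ φ hφ i
    have hmem : τ (p i) (b i) ∈ span L b (p ⁻¹' {p i}) :=
      apply_mem_of_mem_setStab (hτ _) (mem_span rfl)
    -- `φ` agrees with the inverse of `τ (p i)` on the generators of that factor, hence on the whole
    -- factor, which contains `τ (p i) (b i)`.
    have : Set.EqOn φ (τ (p i))⁻¹.toHom (b '' (p ⁻¹' {p i})) := by
      rintro _ ⟨j, hj, rfl⟩
      have hj : p j = p i := hj
      rw [hφ, hj]
      rfl
    rw [Hom.eqOn_closure this hmem]
    exact aut_inv_apply_self _ _
  obtain ⟨σ, hσ⟩ := hb.exists_aut (fun i => τ (p i) (b i)) (fun i => (τ (p i))⁻¹ (b i))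
    (key τ hτ) (fun φ hφ => key (fun k => (τ k)⁻¹) (fun k => inv_mem (hτ k)) φ
      (fun i => by rw [hφ, inv_inv]))
  have h : ∀ k, ∀ x ∈ span L b (p ⁻¹' {k}), σ x = τ k x := by
    intro k x hx
    refine aut_eqOn_span (fun i hi => ?_) hx
    have hi : p i = k := hi
    rw [hσ, hi]
  refine ⟨σ, fun k x hx => ⟨h k x hx, ?_⟩⟩
  have hx' := apply_mem_of_mem_setStab (inv_mem (hτ k)) hx
  have := h k _ hx'
  rw [aut_apply_inv_self] at this
  rw [← this, aut_inv_apply_self, this]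

/-! ### Bounded length of automorphisms supported by a moiety -/

/-- Diagonal argument: for a generating set `S` and a free decomposition into factors indexed by
`ℕ`, there is `n` such that all automorphisms of the `n`-th factor are induced by automorphisms of
length at most `n` that also stabilize the complementary factor. -/
theorem exists_full (hb : FreeOn L b) (p : ι → ℕ) {S : Set (F ≃[L] F)}
    (hS : Subgroup.closure S = ⊤) :
    ∃ n : ℕ, ∀ τ ∈ setStab (span L b (p ⁻¹' {n})), ∃ s : F ≃[L] F, length S s ≤ n ∧
      s ∈ setStab (span L b (p ⁻¹' {n})ᶜ) ∧ ∀ x ∈ span L b (p ⁻¹' {n}), s x = τ x := by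
  by_contra! hc
  choose τ hτ H using hc
  -- Counterexamples for all `n` are glued into a single `σ`. Its length is at most some `n`, and
  -- for that `n` it induces `τ n`, a contradiction.
  obtain ⟨σ, hσ⟩ := hb.exists_aut_glue p τ hτ
  obtain ⟨n, hn⟩ := exists_length_le hS σ
  obtain ⟨x, hx, hne⟩ := H n σ hn <| mem_setStab_span_iff.2 fun i hi => by
    have hle : span L b (p ⁻¹' {p i}) ≤ span L b (p ⁻¹' {n})ᶜ :=
      span_mono fun j hj hjn => hi (by
        rw [Set.mem_preimage, Set.mem_singleton_iff] at *
        rw [← hj, hjn])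
    have hi' : b i ∈ span L b (p ⁻¹' {p i}) := mem_span rfl
    rw [(hσ _ _ hi').1, (hσ _ _ hi').2]
    exact ⟨hle (apply_mem_of_mem_setStab (hτ _) hi'),
      hle (apply_mem_of_mem_setStab (inv_mem (hτ _)) hi')⟩
  exact hne (hσ n x hx).1

/-- An infinite swindle: the automorphisms supported by one layer `m = n`, `j = 0` are commutators
with a fixed automorphism `ρ`, all taken in the automorphism group of the factor `m = n`. -/
theorem exists_commutator {K : Type*} {b : K × ℤ × ℕ → F} (hb : FreeOn L b) (n : ℕ) :
    ∃ ρ ∈ fixStab (span L b ((·.2.2) ⁻¹' {n})ᶜ) (span L b ((·.2.2) ⁻¹' {n})),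
      ∀ σ ∈ fixStab (span L b ((·.2) ⁻¹' {(0, n)})ᶜ) (span L b ((·.2) ⁻¹' {(0, n)})),
        ∃ α ∈ setStab (span L b ((·.2.2) ⁻¹' {n})), σ = α * ρ * α⁻¹ * ρ⁻¹ := by
  -- Shift by `j` along `ℤ` inside the factor `m = n`, identity elsewhere.
  let π : ℤ → Equiv.Perm (K × ℤ × ℕ) := fun j =>
    { toFun := fun i => (i.1, if i.2.2 = n then i.2.1 + j else i.2.1, i.2.2)
      invFun := fun i => (i.1, if i.2.2 = n then i.2.1 - j else i.2.1, i.2.2)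
      left_inv := by rintro ⟨k, j', m⟩; by_cases h : m = n <;> simp [h]
      right_inv := by rintro ⟨k, j', m⟩; by_cases h : m = n <;> simp [h] }
  choose ρ hρ using fun j => hb.exists_aut_perm (π j)
  have hρn : ∀ j k i, ρ j (b (k, i, n)) = b (k, i + j, n) := fun j k i => by simp [hρ, π]
  have hρm : ∀ j k i m, m ≠ n → ρ j (b (k, i, m)) = b (k, i, m) := fun j k i m hm => by
    simp [hρ, π, hm]
  have hρinv : ∀ j k i, (ρ j)⁻¹ (b (k, i, n)) = b (k, i - j, n) := fun j k i => by
    have := hρn j k (i - j)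
    rw [sub_add_cancel] at this
    rw [← this, aut_inv_apply_self]
  have hρadd : ∀ i j x, ρ i (ρ j x) = ρ (j + i) x := by
    intro i j x
    have : ρ i * ρ j = ρ (j + i) := hb.aut_ext <| by
      rintro ⟨k, l, m⟩
      rw [aut_mul_apply]
      by_cases h : m = n
      · subst h
        rw [hρn, hρn, hρn, add_assoc]
      · rw [hρm _ _ _ _ h, hρm _ _ _ _ h, hρm _ _ _ _ h]
    rw [← this, aut_mul_apply]
  have hlayer : ∀ j, ∀ x ∈ span L b ((·.2) ⁻¹' {(0, n)}),
      ρ j x ∈ span L b ((·.2) ⁻¹' {(j, n)}) := by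
    intro j x hx
    refine aut_apply_mem_span ?_ hx
    rintro ⟨k, i, m⟩ hi
    obtain ⟨rfl, rfl⟩ : i = 0 ∧ m = n := by simpa using hi
    rw [hρn]
    exact mem_span (by simp)
  have hlayerinv : ∀ j, ∀ x ∈ span L b ((·.2) ⁻¹' {(j, n)}),
      (ρ j)⁻¹ x ∈ span L b ((·.2) ⁻¹' {(0, n)}) := by
    intro j x hx
    refine aut_apply_mem_span ?_ hx
    rintro ⟨k, i, m⟩ hi
    obtain ⟨rfl, rfl⟩ : i = j ∧ m = n := by simpa using hi
    rw [hρinv]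
    exact mem_span (by simp)
  refine ⟨ρ 1, mem_fixStab_iff.2 ⟨fun x hx => ?_, mem_setStab_span_iff.2 ?_⟩, fun σ hσ => ?_⟩
  · refine aut_eqOn_span (τ := 1) ?_ hx
    rintro ⟨k, i, m⟩ hi
    exact hρm _ _ _ _ (by simpa using hi)
  · rintro ⟨k, i, m⟩ hi
    obtain rfl : m = n := by simpa using hi
    rw [hρn, hρinv]
    exact ⟨mem_span rfl, mem_span rfl⟩
  obtain ⟨hσ₁, hσ₂⟩ := mem_fixStab_iff.1 hσ
  -- `α` will act as a copy of `σ` on every layer `j ≥ 0`. Conjugation by `ρ 1` moves these copies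
  -- to the layers `j ≥ 1`, so the commutator keeps only the copy at `j = 0`.
  let τ : ℤ × ℕ → F ≃[L] F := fun q =>
    if q.2 = n ∧ 0 ≤ q.1 then ρ q.1 * σ * (ρ q.1)⁻¹ else 1
  have hτ : ∀ q, τ q ∈ setStab (span L b ((·.2) ⁻¹' {q})) := by
    rintro ⟨j, m⟩
    by_cases h : m = n ∧ 0 ≤ j
    · obtain ⟨rfl, hj⟩ := h
      simp only [τ, hj, and_self, if_true]
      refine mem_setStab_iff.2 fun x hx => ⟨?_, ?_⟩
      · exact hlayer _ _ (apply_mem_of_mem_setStab hσ₂ (hlayerinv _ _ hx))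
      · rw [mul_inv_rev, mul_inv_rev, inv_inv]
        exact hlayer _ _ (apply_mem_of_mem_setStab (inv_mem hσ₂) (hlayerinv _ _ hx))
    · simp only [τ, h, if_false]
      exact one_mem _
  obtain ⟨α, hα⟩ := hb.exists_aut_glue (·.2) τ hτ
  have hle : ∀ j, span L b ((·.2) ⁻¹' {(j, n)}) ≤ span L b ((·.2.2) ⁻¹' {n}) := fun j =>
    span_mono <| by
      rintro ⟨k, i, m⟩ hi
      simp only [Set.mem_preimage, Set.mem_singleton_iff, Prod.mk.injEq] at hi ⊢
      exact hi.2
  refine ⟨α, mem_setStab_span_iff.2 ?_, ?_⟩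
  · rintro ⟨k, i, m⟩ hi
    obtain rfl : m = n := by simpa using hi
    have hi' : b (k, i, m) ∈ span L b ((·.2) ⁻¹' {(i, m)}) := mem_span rfl
    rw [(hα _ _ hi').1, (hα _ _ hi').2]
    exact ⟨hle _ (apply_mem_of_mem_setStab (hτ _) hi'),
      hle _ (apply_mem_of_mem_setStab (inv_mem (hτ _)) hi')⟩
  · rw [eq_mul_inv_iff_mul_eq, eq_mul_inv_iff_mul_eq]
    have hαb : ∀ k i m, α (b (k, i, m)) = τ (i, m) (b (k, i, m)) := fun k i m =>
      (hα (i, m) _ (mem_span rfl)).1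
    have hσb : ∀ k i m, (i, m) ≠ (0, n) → σ (b (k, i, m)) = b (k, i, m) := fun k i m h =>
      hσ₁ _ (mem_span h)
    have hτpos : ∀ k i, 0 ≤ i → τ (i, n) (b (k, i, n)) = ρ i (σ (b (k, 0, n))) := by
      intro k i hi
      simp only [τ, hi, and_self, if_true, aut_mul_apply]
      rw [hρinv, sub_self]
    have hτneg : ∀ k i m, ¬ (m = n ∧ 0 ≤ i) → τ (i, m) (b (k, i, m)) = b (k, i, m) := by
      intro k i m h
      simp only [τ, h, if_false, aut_one_apply]
    refine hb.aut_ext ?_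
    rintro ⟨k, i, m⟩
    simp only [aut_mul_apply]
    rw [hαb]
    by_cases hm : m = n
    · subst hm
      rw [hρn, hαb]
      rcases lt_or_ge i 0 with hi | hi
      · rw [hτneg _ _ _ (by omega), hρn]
        -- The boundary case is `i = -1`: `α` fixes the layer, but the shift takes it to layer `0`,
        -- where `σ` acts.
        rcases (show i + 1 ≤ 0 by omega).lt_or_eq with hi' | hi'
        · rw [hτneg _ _ _ (by omega), hσb _ _ _ (by simp; omega)]
        · rw [hτpos _ _ hi'.ge, hi']
          have h0 : ρ 0 = 1 := by
            refine hb.aut_ext ?_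
            rintro ⟨k, i, l⟩
            simp [hρ, π, aut_one_apply]
          rw [h0, aut_one_apply]
      · rw [hτpos _ _ hi, hτpos _ _ (by omega), hρadd]
        -- The image lies in layer `i + 1 ≥ 1`, which `σ` fixes pointwise.
        refine hσ₁ _ (span_mono ?_ (hlayer (i + 1) _ (apply_mem_of_mem_setStab hσ₂ (mem_span rfl))))
        rintro ⟨k', i', m'⟩ h
        simp only [Set.mem_preimage, Set.mem_singleton_iff, Prod.mk.injEq, Set.mem_compl_iff]
          at h ⊢
        omega
    · rw [hτneg _ _ _ (by tauto), hρm _ _ _ _ hm, hσb _ _ _ (by simp [hm]), hαb,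
        hτneg _ _ _ (by tauto)]

/-- With respect to a generating set, the automorphisms supported by one layer have bounded
length. -/
theorem exists_length_le_of_layer {K : Type*} {b : K × ℤ × ℕ → F} (hb : FreeOn L b)
    {S : Set (F ≃[L] F)} (hS : Subgroup.closure S = ⊤) :
    ∃ n k : ℕ, ∀ σ ∈ fixStab (span L b ((·.2) ⁻¹' {(0, n)})ᶜ) (span L b ((·.2) ⁻¹' {(0, n)})),
      length S σ ≤ k := by
  obtain ⟨n, hn⟩ := hb.exists_full (·.2.2) hS
  obtain ⟨ρ, hρ, H⟩ := hb.exists_commutator n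
  obtain ⟨hρ₁, hρ₂⟩ := mem_fixStab_iff.1 hρ
  obtain ⟨m, hm⟩ := exists_length_le hS ρ
  refine ⟨n, n + m + n + m, fun σ hσ => ?_⟩
  obtain ⟨α, hα, hσα⟩ := H σ hσ
  obtain ⟨s, hs, hs', hsα⟩ := hn α hα
  -- `s` may replace `α`: they agree on the `n`-th factor, while on the complementary factor, which
  -- `s` stabilizes, both `ρ` and `σ` are trivial.
  suffices σ = s * ρ * s⁻¹ * ρ⁻¹ from this ▸
    length_mul_le (length_mul_le (length_mul_le hs hm) (length_inv_le hs)) (length_inv_le hm)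
  rw [eq_mul_inv_iff_mul_eq, eq_mul_inv_iff_mul_eq] at hσα ⊢
  refine hb.aut_ext fun i => ?_
  by_cases hi : i ∈ (·.2.2) ⁻¹' {n}
  · have hbi : b i ∈ span L b ((·.2.2) ⁻¹' {n}) := mem_span hi
    have := DFunLike.congr_fun hσα (b i)
    simp only [aut_mul_apply] at this ⊢
    rw [hsα _ hbi, hsα _ (apply_mem_of_mem_setStab hρ₂ hbi), this]
  · have hbi : b i ∈ span L b ((·.2.2) ⁻¹' {n})ᶜ := mem_span hi
    have hsi := apply_mem_of_mem_setStab hs' hbi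
    simp only [aut_mul_apply]
    rw [hρ₁ _ hsi, hρ₁ _ hbi]
    refine (mem_fixStab_iff.1 hσ).1 _ (span_mono ?_ hsi)
    rintro ⟨k, j, l⟩ h h'
    simp only [Set.mem_preimage, Set.mem_singleton_iff, Prod.mk.injEq, Set.mem_compl_iff] at h h'
    exact h h'.2

/-- With respect to a generating set, the automorphisms supported by a moiety of a free basis have
bounded length. -/
theorem exists_length_le_of_moiety {ι : Type*} {b : ι → F} (hb : FreeOn L b) {T : Set ι}
    (hT : T.Infinite) (hcard : Cardinal.mk T = Cardinal.mk (Tᶜ : Set ι)) {S : Set (F ≃[L] F)}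
    (hS : Subgroup.closure S = ⊤) :
    ∃ k : ℕ, ∀ σ ∈ fixStab (span L b Tᶜ) (span L b T), length S σ ≤ k := by
  have hT' : Cardinal.aleph0 ≤ Cardinal.mk T := Cardinal.aleph0_le_mk_iff.2 hT.to_subtype
  have hι : Cardinal.mk ι = Cardinal.mk T := by
    rw [← Cardinal.mk_sum_compl T, ← hcard, Cardinal.add_eq_self hT']
  have hprod : ∀ (X : Type) [Countable X] [Nonempty X],
      Cardinal.mk (T × X) = Cardinal.mk T := by
    intro X _ _
    rw [Cardinal.mk_prod, Cardinal.lift_uzero]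
    refine Cardinal.mul_eq_left hT' ((Cardinal.lift_le_aleph0.2 Cardinal.mk_le_aleph0).trans hT') ?_
    simp
  obtain ⟨e⟩ : Nonempty (T × ℤ × ℕ ≃ ι) := Cardinal.eq.1 ((hprod _).trans hι.symm)
  obtain ⟨n, k, hk⟩ := (hb.comp_equiv e).exists_length_le_of_layer hS
  set A : Set (T × ℤ × ℕ) := (·.2) ⁻¹' {(0, n)} with hA
  rw [span_comp, span_comp, Set.image_compl_eq e.bijective] at hk
  have hA₁ : Cardinal.mk (e '' A) = Cardinal.mk T := by
    rw [Cardinal.mk_image_eq e.injective]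
    refine Cardinal.mk_congr ⟨fun a => a.1.1, fun t => ⟨(t, 0, n), rfl⟩, ?_, fun t => rfl⟩
    rintro ⟨⟨t, q⟩, hq⟩
    have hq : q = (0, n) := hq
    simp [hq]
  have hA₂ : Cardinal.mk ((e '' A)ᶜ : Set ι) = Cardinal.mk T := by
    refine le_antisymm ((Cardinal.mk_set_le _).trans hι.le) ?_
    -- The neighbouring layer `(1, n)` is a copy of `T` outside the layer `(0, n)`.
    refine Cardinal.mk_le_of_injective (f := fun t => ⟨e (t, 1, n), ?_⟩) ?_
    · rintro ⟨a, ha, hae⟩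
      rw [e.injective.eq_iff] at hae
      subst hae
      simp [hA] at ha
    · intro t t' h
      simpa using h
  obtain ⟨f₁⟩ := Cardinal.eq.1 hA₁
  obtain ⟨f₂⟩ := Cardinal.eq.1 (hA₂.trans hcard)
  obtain ⟨π, hπ₁, hπ₂⟩ := exists_perm_of_equiv f₁ f₂
  obtain ⟨δ, hδ⟩ := hb.exists_aut_perm π
  have hδinv : ∀ i, δ⁻¹ (b i) = b (π.symm i) := fun i => by
    rw [← aut_inv_apply_self δ (b (π.symm i)), hδ, Equiv.apply_symm_apply]
  have hδ₁ : ∀ x ∈ span L b (e '' A), δ x ∈ span L b T := fun x hx =>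
    aut_apply_mem_span (fun i hi => hδ i ▸ mem_span (hπ₁ i hi)) hx
  have hδ₂ : ∀ x ∈ span L b (e '' A)ᶜ, δ x ∈ span L b Tᶜ := fun x hx =>
    aut_apply_mem_span (fun i hi => hδ i ▸ mem_span (hπ₂ i hi)) hx
  have hδ₃ : ∀ x ∈ span L b T, δ⁻¹ x ∈ span L b (e '' A) := fun x hx =>
    aut_apply_mem_span (fun i hi => hδinv i ▸ mem_span (by
      by_contra h
      exact hπ₂ _ h (by simpa using hi))) hx
  obtain ⟨m, hm⟩ := exists_length_le hS δ
  refine ⟨m + k + m, fun σ hσ => ?_⟩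
  obtain ⟨hσ₁, hσ₂⟩ := mem_fixStab_iff.1 hσ
  have hlen : length S (δ⁻¹ * σ * δ) ≤ k := hk _ <| mem_fixStab_iff.2
    ⟨fun x hx => by
      rw [aut_mul_apply, aut_mul_apply, hσ₁ _ (hδ₂ x hx), aut_inv_apply_self],
    mem_setStab_iff.2 fun x hx => ⟨?_, ?_⟩⟩
  · have : σ = δ * (δ⁻¹ * σ * δ) * δ⁻¹ := by group
    rw [this]
    exact length_mul_le (length_mul_le hm hlen) (length_inv_le hm)
  · exact hδ₃ _ (apply_mem_of_mem_setStab hσ₂ (hδ₁ x hx))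
  · rw [mul_inv_rev, mul_inv_rev, inv_inv]
    exact hδ₃ _ (apply_mem_of_mem_setStab (inv_mem hσ₂) (hδ₁ x hx))

end FreeOn

end FreeOn

end BMN

namespace BMN

open FirstOrder.Language FirstOrder.Language.Substructure

/-! ### Invariance of infinite rank -/

section Rank

variable {L : FirstOrder.Language.{u, v}} {F : Type w} [L.Structure F]

theorem exists_finset_mem_span {ι : Type*} {b : ι → F} {x : F}
    (hx : x ∈ closure L (Set.range b)) : ∃ s : Finset ι, x ∈ span L b s := by
  classical
  refine closure_induction hx ?_ ?_
  · intro n f y hy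
    choose s hs using hy
    refine ⟨Finset.univ.biUnion s, fun_mem _ f y fun i => ?_⟩
    exact span_mono (fun j hj => by simpa using ⟨i, hj⟩) (hs i)
  · rintro _ ⟨i, rfl⟩
    exact ⟨{i}, mem_span (by simp)⟩

namespace FreeOn

theorem apply_notMem_span [Nontrivial F] {ι : Type*} {b : ι → F} (hb : FreeOn L b) {i : ι}
    {T : Set ι} (hi : i ∉ T) : b i ∉ span L b T := by
  classical
  intro h
  obtain ⟨y, hy⟩ := exists_ne (b i)
  -- This endomorphism moves `b i` but is the identity on `span L b T`.
  obtain ⟨g, hg⟩ := hb.2 (fun j => if j = i then y else b j)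
  have : Set.EqOn g (Hom.id L F) (b '' T) := by
    rintro _ ⟨j, hj, rfl⟩
    rw [hg, if_neg (fun h : j = i => hi (h ▸ hj))]
    rfl
  have h' := Hom.eqOn_closure this h
  rw [hg, if_pos rfl] at h'
  exact hy h'

/-- Every `b i` involves only finitely many members of `c`, and every member of `c` must occur in
some `b i`, as otherwise it would lie in the span of the others. So `κ` is covered by `ι` many
finite sets. -/
theorem mk_le_mk [Nontrivial F] {ι κ : Type w} [Infinite ι] {b : ι → F} {c : κ → F}
    (hb : FreeOn L b) (hc : FreeOn L c) : Cardinal.mk κ ≤ Cardinal.mk ι := by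
  have hfin : ∀ x : F, ∃ s : Finset κ, x ∈ span L c s := fun x =>
    exists_finset_mem_span (hc.1 ▸ mem_top x)
  choose s hs using hfin
  have hcover : ∀ k, ∃ i, k ∈ s (b i) := by
    intro k
    by_contra! hk
    refine hc.apply_notMem_span (T := {k}ᶜ) (by simp) (?_ : c k ∈ _)
    have : closure L (Set.range b) ≤ span L c {k}ᶜ := closure_le.2 <| by
      rintro _ ⟨i, rfl⟩
      refine span_mono (fun j hj => ?_) (hs (b i))
      rintro rfl
      exact hk i hj
    exact this (hb.1 ▸ mem_top _)
  choose i hi using hcover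
  have : Cardinal.mk κ ≤ Cardinal.mk (Σ j : ι, s (b j)) :=
    Cardinal.mk_le_of_injective (f := fun k => ⟨i k, k, hi k⟩) fun k k' h => by
      have h₁ : ∀ p q : (Σ j : ι, s (b j)), p = q → (p.2 : κ) = q.2 := by
        rintro p _ rfl
        rfl
      exact h₁ _ _ h
  refine this.trans ?_
  rw [Cardinal.mk_sigma]
  refine (Cardinal.sum_le_sum _ (fun _ => Cardinal.aleph0) fun j =>
    (Cardinal.mk_le_aleph0)).trans ?_
  rw [Cardinal.sum_const']
  exact (Cardinal.mul_aleph0_eq (Cardinal.aleph0_le_mk ι)).le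

theorem mk_eq_mk [Nontrivial F] {ι κ : Type w} [Infinite ι] [Infinite κ] {b : ι → F} {c : κ → F}
    (hb : FreeOn L b) (hc : FreeOn L c) : Cardinal.mk ι = Cardinal.mk κ :=
  le_antisymm (hc.mk_le_mk hb) (hb.mk_le_mk hc)

end FreeOn

end Rank

/-! ### Free bases and free products in the variety -/

section Variety

variable {L : FirstOrder.Language.{u, v}} {E : Identities L} {F : Type w} [L.Structure F]

theorem InVariety.of_injective {M N : Type*} [L.Structure M] [L.Structure N]
    (hN : InVariety E N) (f : M →[L] N) (hf : Function.Injective f) : InVariety E M := by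
  intro e he x
  apply hf
  rw [← HomClass.realize_term, ← HomClass.realize_term]
  exact hN e he _

theorem InVariety.substructure (hF : InVariety E F) (A : L.Substructure F) : InVariety E A :=
  hF.of_injective A.subtype.toHom A.subtype.injective

/-- Test algebras in the universe of `F` suffice for a universal property that holds for the test
algebras in a larger universe. -/
theorem exists_ulift (M : Type w) [L.Structure M] (hM : InVariety E M) :
    ∃ (N : Type (max u w)) (_ : L.Structure N), InVariety E N ∧ Nonempty (M ≃[L] N) := by
  let _ : L.Structure (ULift.{u} M) := Equiv.ulift.symm.inducedStructure
  let e : M ≃[L] ULift.{u} M := Equiv.ulift.symm.inducedStructureEquiv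
  exact ⟨ULift.{u} M, inferInstance, hM.of_injective e.symm.toHom e.symm.injective, ⟨e⟩⟩

theorem IsBasis.exists_hom {B : Set F} (hB : IsBasis E B) {M : Type w} [L.Structure M]
    (hM : InVariety E M) (f : B → M) : ∃ g : F →[L] M, ∀ b : B, g b = f b := by
  obtain ⟨N, _, hN, ⟨e⟩⟩ := exists_ulift.{u, v, w} M hM
  obtain ⟨g, hg, -⟩ := hB.2 N hN (fun b => e (f b))
  exact ⟨e.symm.toHom.comp g, fun b => by
    rw [Hom.comp_apply, hg]
    exact e.symm_apply_apply _⟩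

theorem IsBasis.hom_ext {B : Set F} (hB : IsBasis E B) {M : Type w} [L.Structure M]
    (hM : InVariety E M) {g h : F →[L] M} (H : ∀ b ∈ B, g b = h b) : g = h := by
  obtain ⟨N, _, hN, ⟨e⟩⟩ := exists_ulift.{u, v, w} M hM
  have := (hB.2 N hN (fun b => e (g b))).unique (y₁ := e.toHom.comp g) (y₂ := e.toHom.comp h)
    (fun b => rfl) (fun b => congrArg e (H b b.2).symm)
  ext x
  exact e.injective (DFunLike.congr_fun this x)

theorem IsFreeProduct.exists_hom {U₁ U₂ W : L.Substructure F} (h : IsFreeProduct E U₁ U₂ W)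
    {M : Type w} [L.Structure M] (hM : InVariety E M) (f₁ : U₁ →[L] M) (f₂ : U₂ →[L] M)
    (f₃ : W →[L] M) :
    ∃ g : F →[L] M, (∀ x : U₁, g x = f₁ x) ∧ (∀ x : U₂, g x = f₂ x) ∧ ∀ x : W, g x = f₃ x := by
  obtain ⟨N, _, hN, ⟨e⟩⟩ := exists_ulift.{u, v, w} M hM
  obtain ⟨g, ⟨h₁, h₂, h₃⟩, -⟩ := h.2 N hN (e.toHom.comp f₁) (e.toHom.comp f₂) (e.toHom.comp f₃)
  refine ⟨e.symm.toHom.comp g, fun x => ?_, fun x => ?_, fun x => ?_⟩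
  · rw [Hom.comp_apply, h₁]
    exact e.symm_apply_apply _
  · rw [Hom.comp_apply, h₂]
    exact e.symm_apply_apply _
  · rw [Hom.comp_apply, h₃]
    exact e.symm_apply_apply _

theorem IsFreeProduct.hom_ext {U₁ U₂ W : L.Substructure F} (h : IsFreeProduct E U₁ U₂ W)
    {M : Type w} [L.Structure M] (hM : InVariety E M) {g g' : F →[L] M}
    (h₁ : ∀ x ∈ U₁, g x = g' x) (h₂ : ∀ x ∈ U₂, g x = g' x) (h₃ : ∀ x ∈ W, g x = g' x) :
    g = g' := by
  obtain ⟨N, _, hN, ⟨e⟩⟩ := exists_ulift.{u, v, w} M hM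
  let k := e.toHom.comp g
  have := (h.2 N hN (k.domRestrict U₁) (k.domRestrict U₂) (k.domRestrict W)).unique
    (y₁ := k) (y₂ := e.toHom.comp g') ⟨fun _ => rfl, fun _ => rfl, fun _ => rfl⟩
    ⟨fun x => congrArg e (h₁ x x.2).symm, fun x => congrArg e (h₂ x x.2).symm,
      fun x => congrArg e (h₃ x x.2).symm⟩
  ext x
  exact e.injective (DFunLike.congr_fun this x)

theorem IsBasis.freeOn {B : Set F} (hB : IsBasis E B) : FreeOn L ((↑) : B → F) := by
  refine ⟨?_, hB.exists_hom hB.1⟩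
  rw [Subtype.range_coe, eq_top_iff]
  intro x _
  let C := closure L B
  obtain ⟨g, hg⟩ := hB.exists_hom (hB.1.substructure C) (fun b => ⟨b, subset_closure b.2⟩)
  -- Uniqueness of extensions forces generation: the map into `C` followed by the inclusion fixes
  -- `B`, so it is the identity.
  have : C.subtype.toHom.comp g = Hom.id L F := hB.hom_ext hB.1 fun b hb => by
    rw [Hom.comp_apply, hg ⟨b, hb⟩]
    rfl
  have hx : (g x : F) = x := DFunLike.congr_fun this x
  exact hx ▸ (g x).2

theorem IsFreeProduct.sup_eq_top {U₁ U₂ W : L.Substructure F} (h : IsFreeProduct E U₁ U₂ W) :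
    U₁ ⊔ U₂ ⊔ W = ⊤ := by
  rw [eq_top_iff]
  intro x _
  have h₁ : U₁ ≤ U₁ ⊔ U₂ ⊔ W := le_sup_left.trans le_sup_left
  have h₂ : U₂ ≤ U₁ ⊔ U₂ ⊔ W := le_sup_right.trans le_sup_left
  have h₃ : W ≤ U₁ ⊔ U₂ ⊔ W := le_sup_right
  obtain ⟨g, hg₁, hg₂, hg₃⟩ := h.exists_hom (h.1.substructure (U₁ ⊔ U₂ ⊔ W))
    (inclusion h₁).toHom (inclusion h₂).toHom (inclusion h₃).toHom
  have : (U₁ ⊔ U₂ ⊔ W).subtype.toHom.comp g = Hom.id L F :=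
    h.hom_ext h.1 (fun x hx => congrArg Subtype.val (hg₁ ⟨x, hx⟩))
      (fun x hx => congrArg Subtype.val (hg₂ ⟨x, hx⟩))
      (fun x hx => congrArg Subtype.val (hg₃ ⟨x, hx⟩))
  have hx : (g x : F) = x := DFunLike.congr_fun this x
  exact hx ▸ (g x).2

/-- Maps defined on part of a free basis extend to endomorphisms. -/
theorem IsBasis.exists_hom_of_subset {B J : Set F} (hB : IsBasis E B) (hJ : J ⊆ B) (f : J → F) :
    ∃ g : F →[L] F, ∀ j : J, g j = f j := by
  classical
  obtain ⟨g, hg⟩ := hB.exists_hom hB.1 (fun b => if h : (b : F) ∈ J then f ⟨b, h⟩ else b)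
  exact ⟨g, fun j => by rw [hg ⟨j, hJ j.2⟩, dif_pos j.2]⟩

/-- Free bases of the factors of a free product make up a free basis of the product. -/
theorem IsFreeProduct.freeOn {J₁ J₂ J₃ : Set F}
    (h : IsFreeProduct E (closure L J₁) (closure L J₂) (closure L J₃))
    (h₁ : ∀ f : J₁ → F, ∃ g : F →[L] F, ∀ j : J₁, g j = f j)
    (h₂ : ∀ f : J₂ → F, ∃ g : F →[L] F, ∀ j : J₂, g j = f j)
    (h₃ : ∀ f : J₃ → F, ∃ g : F →[L] F, ∀ j : J₃, g j = f j) :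
    FreeOn L (Sum.elim (Sum.elim ((↑) : J₁ → F) ((↑) : J₂ → F)) ((↑) : J₃ → F)) := by
  refine ⟨?_, fun f => ?_⟩
  · rw [Set.Sum.elim_range, Set.Sum.elim_range, Subtype.range_coe, Subtype.range_coe,
      Subtype.range_coe, Substructure.closure_union, Substructure.closure_union]
    exact h.sup_eq_top
  · obtain ⟨g₁, hg₁⟩ := h₁ (fun j => f (.inl (.inl j)))
    obtain ⟨g₂, hg₂⟩ := h₂ (fun j => f (.inl (.inr j)))
    obtain ⟨g₃, hg₃⟩ := h₃ (fun j => f (.inr j))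
    obtain ⟨g, H₁, H₂, H₃⟩ := h.exists_hom h.1 (g₁.domRestrict _) (g₂.domRestrict _)
      (g₃.domRestrict _)
    refine ⟨g, ?_⟩
    rintro ((j | j) | j)
    · exact (H₁ ⟨j, subset_closure j.2⟩).trans (hg₁ j)
    · exact (H₂ ⟨j, subset_closure j.2⟩).trans (hg₂ j)
    · exact (H₃ ⟨j, subset_closure j.2⟩).trans (hg₃ j)

theorem mk_eq_of_mk_eq_mk_diff {B J : Set F} (hB : B.Infinite) (hJ : J ⊆ B)
    (h : Cardinal.mk J = Cardinal.mk (B \ J : Set F)) : Cardinal.mk J = Cardinal.mk B := by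
  have hsum := Cardinal.mk_sdiff_add_mk hJ
  rw [← h] at hsum
  have hinf : Cardinal.aleph0 ≤ Cardinal.mk J := by
    by_contra! hlt
    have := Cardinal.add_lt_aleph0 hlt hlt
    rw [hsum] at this
    exact this.not_ge (Cardinal.aleph0_le_mk_iff.2 hB.to_subtype)
  rwa [Cardinal.add_eq_self hinf] at hsum

/-- If the width relative to the subgroups attached to one factorization is finite, then the
automorphism group is of universally finite width. -/
theorem IsMoietousFactorization.universallyFiniteWidth [L.IsAlgebraic]
    {U₁ U₂ W : L.Substructure F} (h : IsMoietousFactorization E U₁ U₂ W)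
    (hw : width (macphersonSet U₁ U₂ W) ≠ ⊤) : UniversallyFiniteWidth (F ≃[L] F) := by
  obtain ⟨⟨B₁, hB₁, hB₁', J₁, hJ₁, hc₁, rfl⟩, ⟨B₂, hB₂, hB₂', J₂, hJ₂, hc₂, rfl⟩,
    ⟨B₃, hB₃, hB₃', J₃, hJ₃, hc₃, rfl⟩, hfree⟩ := h
  have : Infinite B₁ := hB₁'.to_subtype
  have : Infinite B₂ := hB₂'.to_subtype
  have : Infinite B₃ := hB₃'.to_subtype
  have : Infinite F := Infinite.of_injective ((↑) : B₁ → F) Subtype.val_injective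
  have e₁ := mk_eq_of_mk_eq_mk_diff hB₁' hJ₁ hc₁
  have e₂ : Cardinal.mk J₂ = Cardinal.mk J₁ := by
    rw [e₁, mk_eq_of_mk_eq_mk_diff hB₂' hJ₂ hc₂, hB₁.freeOn.mk_eq_mk hB₂.freeOn]
  have e₃ : Cardinal.mk J₃ = Cardinal.mk J₁ := by
    rw [e₁, mk_eq_of_mk_eq_mk_diff hB₃' hJ₃ hc₃, hB₁.freeOn.mk_eq_mk hB₃.freeOn]
  have hinf : Cardinal.aleph0 ≤ Cardinal.mk J₁ := e₁ ▸ Cardinal.aleph0_le_mk B₁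
  have hb := hfree.freeOn (hB₁.exists_hom_of_subset hJ₁) (hB₂.exists_hom_of_subset hJ₂)
    (hB₃.exists_hom_of_subset hJ₃)
  set b := Sum.elim (Sum.elim ((↑) : J₁ → F) ((↑) : J₂ → F)) ((↑) : J₃ → F)
  intro S hS
  have key : ∀ T : Set ((J₁ ⊕ J₂) ⊕ J₃), Cardinal.mk T = Cardinal.mk J₁ →
      Cardinal.mk (Tᶜ : Set _) = Cardinal.mk J₁ →
        ∃ k : ℕ, ∀ σ ∈ fixStab (span L b Tᶜ) (span L b T), length S σ ≤ k := fun T h₁ h₂ =>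
    hb.exists_length_le_of_moiety
      (Set.infinite_coe_iff.1 (Cardinal.aleph0_le_mk_iff.1 (h₁ ▸ hinf))) (h₁.trans h₂.symm) hS
  have htot : Cardinal.mk ((J₁ ⊕ J₂) ⊕ J₃) = Cardinal.mk J₁ := by
    simp [e₂, e₃, Cardinal.add_eq_self hinf]
  -- The factor `W` alone has full rank, so the indices belonging to `U₁` and `W`, or to `U₂` and
  -- `W`, form a moiety.
  have hbig : ∀ T : Set ((J₁ ⊕ J₂) ⊕ J₃), Set.range Sum.inr ⊆ T →
      Cardinal.mk T = Cardinal.mk J₁ := fun T hT => by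
    refine le_antisymm ((Cardinal.mk_set_le T).trans htot.le) ?_
    rw [← e₃, ← Cardinal.mk_range_eq (Sum.inr : J₃ → (J₁ ⊕ J₂) ⊕ J₃) Sum.inr_injective]
    exact Cardinal.mk_le_mk_of_subset hT
  obtain ⟨k₁, hk₁⟩ := key (Set.range (Sum.inl ∘ Sum.inr))ᶜ (hbig _ (by rintro _ ⟨j, rfl⟩; simp))
    (by rw [compl_compl, Cardinal.mk_range_eq _ (Sum.inl_injective.comp Sum.inr_injective), e₂])
  obtain ⟨k₂, hk₂⟩ := key (Set.range (Sum.inl ∘ Sum.inl))ᶜ (hbig _ (by rintro _ ⟨j, rfl⟩; simp))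
    (by rw [compl_compl, Cardinal.mk_range_eq _ (Sum.inl_injective.comp Sum.inl_injective)])
  have s₁ : span L b (Set.range (Sum.inl ∘ Sum.inl)) = closure L J₁ := by
    rw [span, ← Set.range_comp, ← Function.comp_assoc]
    simp [b]
  have s₂ : span L b (Set.range (Sum.inl ∘ Sum.inr)) = closure L J₂ := by
    rw [span, ← Set.range_comp, ← Function.comp_assoc]
    simp [b]
  have s₃ : span L b (Set.range (Sum.inl ∘ Sum.inr))ᶜ = closure L J₁ ⊔ closure L J₃ := by
    rw [span, ← Substructure.closure_union]
    congr 1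
    ext x
    simp [b]
    grind
  have s₄ : span L b (Set.range (Sum.inl ∘ Sum.inl))ᶜ = closure L J₂ ⊔ closure L J₃ := by
    rw [span, ← Substructure.closure_union]
    congr 1
    ext x
    simp [b]
    grind
  rw [compl_compl, s₂, s₃] at hk₁
  rw [compl_compl, s₁, s₄] at hk₂
  refine width_ne_top_of_length_le (k := max k₁ k₂) hw ?_
  rintro σ (hσ | hσ)
  · exact (hk₁ σ hσ).trans (by exact_mod_cast le_max_left _ _)
  · exact (hk₂ σ hσ).trans (by exact_mod_cast le_max_right _ _)

theorem hom_ext_closure {s : Set F} {M : Type*} [L.Structure M] {f g : closure L s →[L] M}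
    (h : ∀ x (hx : x ∈ s), f ⟨x, subset_closure hx⟩ = g ⟨x, subset_closure hx⟩) : f = g := by
  ext ⟨x, hx⟩
  refine closure_induction' s (p := fun x hx => f ⟨x, hx⟩ = g ⟨x, hx⟩) h ?_ hx
  intro n φ y hy
  choose hy ih using hy
  have hf := f.map_fun φ (fun i => ⟨y i, hy i⟩)
  have hg := g.map_fun φ (fun i => ⟨y i, hy i⟩)
  refine ⟨fun_mem _ φ y hy, ?_⟩
  exact hf.trans ((congrArg (Structure.funMap φ) (funext ih)).trans hg.symm)

/-- A basis `B` is cut into three pieces of size `|B|` by a bijection `B × Fin 3 ≃ B`. Without such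
a factorization the existential condition could not follow from universally finite width. -/
theorem exists_isMoietousFactorization (hF : IsFreeOfInfiniteRank E F) :
    ∃ U₁ U₂ W : L.Substructure F, IsMoietousFactorization E U₁ U₂ W := by
  obtain ⟨B, hB, hinf⟩ := hF
  have hinf' : Infinite B := hinf.to_subtype
  have hB₀ := Cardinal.aleph0_le_mk B
  obtain ⟨e⟩ : Nonempty (B × Fin 3 ≃ B) := Cardinal.eq.1 <| by
    rw [Cardinal.mk_prod, Cardinal.lift_uzero]
    exact Cardinal.mul_eq_left hB₀ ((by simp :
      Cardinal.lift (Cardinal.mk (Fin 3)) ≤ Cardinal.aleph0).trans hB₀) (by simp)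
  let t : B → Fin 3 := fun b => (e.symm b).2
  let J : Fin 3 → Set F := fun i => {x | ∃ h : x ∈ B, t ⟨x, h⟩ = i}
  have hJB : ∀ i, J i ⊆ B := fun i x hx => hx.1
  have hJ : ∀ i, Cardinal.mk B ≤ Cardinal.mk (J i) := fun i =>
    Cardinal.mk_le_of_injective (f := fun b => ⟨e (b, i), (e (b, i)).2, by simp [t]⟩)
      fun b b' h => by
        simpa using e.injective (Subtype.ext (Subtype.mk.inj h))
  have hdisj : ∀ i j, i ≠ j → J i ⊆ B \ J j := fun i j hij x hx =>
    ⟨hx.1, fun hx' => hij (hx.2.symm.trans hx'.2)⟩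
  have hmoi : ∀ i, IsMoietous E (closure L (J i)) := fun i => by
    refine ⟨B, hB, hinf, J i, hJB i, le_antisymm ?_ ?_, rfl⟩
    · exact (Cardinal.mk_le_mk_of_subset (hJB i)).trans
        -- In `Fin 3` the index `i + 1` differs from `i`, so its piece is a subset of `B \ J i` of
        -- full size.
        ((hJ (i + 1)).trans (Cardinal.mk_le_mk_of_subset (hdisj _ _ (by simp))))
    · exact (Cardinal.mk_le_mk_of_subset Set.sdiff_subset).trans (hJ i)
  refine ⟨closure L (J 0), closure L (J 1), closure L (J 2), hmoi 0, hmoi 1, hmoi 2, hB.1,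
    fun M _ hM f₁ f₂ f₃ => ?_⟩
  let f : ∀ i, closure L (J i) →[L] M := fun i => match i with
    | 0 => f₁
    | 1 => f₂
    | 2 => f₃
  obtain ⟨g, hg, huniq⟩ := hB.2 M hM fun b => f (t b) ⟨b, subset_closure ⟨b.2, rfl⟩⟩
  have hgf : ∀ i, ∀ x : closure L (J i), g x = f i x := by
    intro i x
    refine DFunLike.congr_fun (hom_ext_closure (f := g.domRestrict _) (g := f i) ?_) x
    rintro y ⟨hy, rfl⟩
    exact hg ⟨y, hy⟩
  refine ⟨g, ⟨hgf 0, hgf 1, hgf 2⟩, ?_⟩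
  rintro g' ⟨h₁, h₂, h₃⟩
  refine huniq g' fun b => ?_
  have hall : ∀ i, ∀ x : closure L (J i), g' x = f i x := by
    intro i
    fin_cases i
    exacts [h₁, h₂, h₃]
  exact hall (t b) ⟨b, subset_closure ⟨b.2, rfl⟩⟩

end Variety

end BMN


theorem mainTheorem3 {L : FirstOrder.Language.{u, v}} [L.IsAlgebraic] (E : BMN.Identities L)
    (hE : BMN.IsBMNVariety.{u, v, w} E) (F : Type w) [L.Structure F]
    (hF : BMN.IsFreeOfInfiniteRank E F) :
    (BMN.UniversallyFiniteWidth (F ≃[L] F) ↔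
      ∃ U₁ U₂ W : L.Substructure F, BMN.IsMoietousFactorization E U₁ U₂ W ∧
        BMN.width (BMN.macphersonSet U₁ U₂ W) ≠ ⊤) ∧
    (∀ U₁ U₂ W : L.Substructure F, BMN.IsMoietousFactorization E U₁ U₂ W →
      (BMN.UniversallyFiniteWidth (F ≃[L] F) ↔
        BMN.width (BMN.macphersonSet U₁ U₂ W) ≠ ⊤)) := by
  have hiff : ∀ U₁ U₂ W : L.Substructure F, BMN.IsMoietousFactorization E U₁ U₂ W →
      (BMN.UniversallyFiniteWidth (F ≃[L] F) ↔
        BMN.width (BMN.macphersonSet U₁ U₂ W) ≠ ⊤) := fun U₁ U₂ W h =>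
    -- The BMN property enters only here, to make the union of the two subgroups a generating set.
    ⟨fun hG => hG _ (hE F hF U₁ U₂ W h), h.universallyFiniteWidth⟩
  refine ⟨⟨fun hG => ?_, ?_⟩, hiff⟩
  · obtain ⟨U₁, U₂, W, h⟩ := BMN.exists_isMoietousFactorization hF
    exact ⟨U₁, U₂, W, h, (hiff U₁ U₂ W h).1 hG⟩
  · rintro ⟨U₁, U₂, W, h, hw⟩
    exact (hiff U₁ U₂ W h).2 hw
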